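/- Let $a_{i,j}, g_{i,j}$ ($1\le j\le i\le s-1$), $b_j, g_{s,j}$ ($1\le j\le s$) and $p_{j,k}$ ($1\le k\le j\le s$) be real coefficients, $s\ge 1$. Put $\varphi_k(z)=\sum_{i\ge0} z^i/(i+k)!$, $\psi_j(z)=\sum_{k=1}^{j}p_{j,k}\varphi_k(z)$, $\widetilde p_j=\sum_{k=1}^{j}p_{j,k}/k!$, and write $w_{i,j}=a_{i,j}$ for $i<s$, $w_{s,j}=b_j$. Consider autonomous systems $y'=f(y)$ with $f:\mathbb R^N\to\mathbb R^N$ of class $C^\infty$, and let $\mathbf J_n=f'(y_n)$. The classical EPIRK method with these coefficients and step size $h$ computes $Y_0=y_n$ and, for $i=1,\dots,s$, $$Y_i=y_n+w_{i,1}\psi_1(g_{i,1}h\mathbf J_n)\,hf(y_n)+\sum_{j=2}^{i}w_{i,j}\psi_j(g_{i,j}h\mathbf J_n)\,h\Delta^{(j-1)}r(Y_0),\qquad y_{n+1}=Y_s,$$ where $r(z)=f(z)-f(y_n)-\mathbf J_n(z-y_n)$ and $\Delta^{(q)}r(Y_0)$ is the $q$-th forward difference at $0$ of the sequence $l\mapsto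 r(Y_l)$. The $K$-method with the same coefficients and Krylov parameter $M$ uses a matrix $\mathbf V$ whose columns are an orthonormal basis of $\mathcal K_M=\operatorname{span}\{f(y_n),\mathbf J_nf(y_n),\dots,\mathbf J_n^{M-1}f(y_n)\}$, and $\mathbf H=\mathbf V^T\mathbf J_n\mathbf V$. It computes $Y_0=y_n$, $\lambda_0=\mathbf V^Ty_n$, and, with $f_l=f(Y_l)$, $\eta_l=\mathbf V^Tf_l$, for $i=1,\dots,s$, $$\lambda_i=\lambda_0+hw_{i,1}\psi_1(hg_{i,1}\mathbf H)\eta_0+\sum_{j=2}^{i}hw_{i,j}\psi_j(hg_{i,j}\mathbf H)\,d_{(j-1)},$$ $$Y_i=\mathbf V\lambda_i+(y_n-\mathbf V\lambda_0)+hw_{i,1}\widetilde p_1(f_0-\mathbf V\eta_0)+\sum_{j=2}^{i}hw_{i,j}\widetilde p_j\,\widetilde r^{\perp}_{(j-1)},\qquad y_{n+1}=Y_s,$$ where $d_{(q)}=\sum_{k=0}^{q}(-1)^k\binom qk(\eta_{q-k}-\mathbf H\lambda_{q-k})$ and $\widetilde r^{\perp}_{(q)}=\sum_{k=0}^{q}(-1)^k\binom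 qk(f_{q-k}-\mathbf V\eta_{q-k})$. A one-step method has order (at least) $q$ if for every $N$, every such $f$ and every $y_n$, its local error satisfies $y_{n+1}-y(t_n+h)=O(h^{q+1})$ as $h\to0^+$, where $y$ is the solution of $y'=f(y)$, $y(t_n)=y_n$; for the $K$-method this is required for every choice of $\mathbf V$. Corollary. If the classical EPIRK method with given coefficients has order $p\ge3$, then for every $M\ge3$ the $K$-method with the same coefficients and Krylov parameter $M$ has order at least three. -/

import Mathlib

open Filter Topology Asymptotics
open scoped ContDiff Nat

namespace EPIRK

noncomputable section

/-! ### Matrix functions -/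

/-- The entire functions `φ_k(z) = ∑_{i ≥ 0} z ^ i / (i + k)!`, evaluated at an element of a
normed algebra (below: at a square matrix, seen as a continuous linear endomorphism). -/
def phi {𝔸 : Type*} [NormedRing 𝔸] [NormedAlgebra ℝ 𝔸] (k : ℕ) (Z : 𝔸) : 𝔸 :=
  ∑' i : ℕ, ((i + k)! : ℝ)⁻¹ • Z ^ i

/-- The coefficients of an `s`-stage EPIRK method. Only the following entries matter:
`a i j` and `g i j` for `1 ≤ j ≤ i ≤ s - 1`, `b j` and `g s j` for `1 ≤ j ≤ s`,
and `p j k` for `1 ≤ k ≤ j ≤ s`. -/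
structure Coeffs where
  /-- number of stages -/
  s : ℕ
  one_le_s : 1 ≤ s
  a : ℕ → ℕ → ℝ
  b : ℕ → ℝ
  g : ℕ → ℕ → ℝ
  p : ℕ → ℕ → ℝ

namespace Coeffs

variable (c : Coeffs)

/-- `ψ_j(z) = ∑_{k=1}^{j} p_{j,k} φ_k(z)`. -/
def psi {𝔸 : Type*} [NormedRing 𝔸] [NormedAlgebra ℝ 𝔸] (j : ℕ) (Z : 𝔸) : 𝔸 :=
  ∑ k ∈ Finset.Icc 1 j, c.p j k • phi k Z

/-- `p̃_j = ∑_{k=1}^{j} p_{j,k} / k!`. -/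
def ptilde (j : ℕ) : ℝ :=
  ∑ k ∈ Finset.Icc 1 j, c.p j k / (k ! : ℝ)

/-- The weights of stage `i`: `a_{i,j}` for an internal stage `i < s`, and `b_j` for the final
stage `i = s`, whose stage vector `Y_s` is the new approximation `y_{n+1}`. -/
def weight (i j : ℕ) : ℝ :=
  if i = c.s then c.b j else c.a i j

end Coeffs

/-! ### Explicit recursions

`explicitSeq x₀ Φ` is the sequence with `x_0 = x₀` and `x_i = Φ (x_0, …, x_{i-1}) i` for `i ≥ 1`,
where `Φ x i` looks only at the entries of `x` of index `< i`. -/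

/-- Auxiliary: the sequence whose entries `0, …, n` are already computed. -/
def explicitTable {X : Type*} (x₀ : X) (Φ : (ℕ → X) → ℕ → X) : ℕ → ℕ → X
  | 0 => fun _ => x₀
  | n + 1 => Function.update (explicitTable x₀ Φ n) (n + 1) (Φ (explicitTable x₀ Φ n) (n + 1))

/-- The sequence generated by an explicit recursion. -/
def explicitSeq {X : Type*} (x₀ : X) (Φ : (ℕ → X) → ℕ → X) (i : ℕ) : X :=
  explicitTable x₀ Φ i i

theorem explicitSeq_zero {X : Type*} (x₀ : X) (Φ : (ℕ → X) → ℕ → X) :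
    explicitSeq x₀ Φ 0 = x₀ := rfl

theorem explicitTable_eq {X : Type*} (x₀ : X) (Φ : (ℕ → X) → ℕ → X) (n l : ℕ) (hl : l ≤ n) :
    explicitTable x₀ Φ n l = explicitSeq x₀ Φ l := by
  induction n with
  | zero =>
    obtain rfl : l = 0 := by omega
    rfl
  | succ n ih =>
    by_cases h : l = n + 1
    · subst h; rfl
    · rw [explicitTable, Function.update_of_ne h]
      exact ih (by omega)

/-- The recursion satisfied by `explicitSeq`. -/
theorem explicitSeq_eq {X : Type*} (x₀ : X) (Φ : (ℕ → X) → ℕ → X)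
    (hΦ : ∀ x x' : ℕ → X, ∀ i, 1 ≤ i → (∀ l < i, x l = x' l) → Φ x i = Φ x' i)
    (i : ℕ) (hi : 1 ≤ i) :
    explicitSeq x₀ Φ i = Φ (explicitSeq x₀ Φ) i := by
  obtain ⟨n, rfl⟩ : ∃ n, i = n + 1 := ⟨i - 1, by omega⟩
  rw [explicitSeq, explicitTable, Function.update_self]
  exact hΦ _ _ _ hi fun l hl => explicitTable_eq x₀ Φ n l (by omega)

/-! ### Classical EPIRK methods -/

/-- `ℝ^N` with the Euclidean norm. -/
abbrev Vec (N : ℕ) : Type := EuclideanSpace ℝ (Fin N)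

/-- The nonlinear remainder `r(z) = f(z) - f(y) - J (z - y)` of the first-order Taylor expansion
of `f` at `y`, with `J = f'(y)`. -/
def remainder {N : ℕ} (f : Vec N → Vec N) (y z : Vec N) : Vec N :=
  f z - f y - fderiv ℝ f y (z - y)

namespace Coeffs

variable (c : Coeffs)

/-- The right-hand side of stage `i` of the classical EPIRK method with step size `h` at `y`:
`y + w_{i,1} ψ_1(g_{i,1} h J) h f(y) + ∑_{j=2}^{i} w_{i,j} ψ_j(g_{i,j} h J) h Δ^{(j-1)} r(Y_0)`,
where `J = f'(y)` is the exact Jacobian and `w_{i,j}` are the weights of stage `i`. -/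
def classicalStageRhs {N : ℕ} (f : Vec N → Vec N) (y : Vec N) (h : ℝ)
    (Y : ℕ → Vec N) (i : ℕ) : Vec N :=
  y + c.weight i 1 • c.psi 1 ((c.g i 1 * h) • fderiv ℝ f y) (h • f y)
    + ∑ j ∈ Finset.Icc 2 i, c.weight i j • c.psi j ((c.g i j * h) • fderiv ℝ f y)
        (h • (fwdDiff 1)^[j - 1] (fun l : ℕ => remainder f y (Y l)) 0)

/-- The stage vectors `Y_0 = y, Y_1, …, Y_{s-1}` and `Y_s = y_{n+1}` of the classical method. -/
def classicalStage {N : ℕ} (f : Vec N → Vec N) (y : Vec N) (h : ℝ) : ℕ → Vec N :=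
  explicitSeq y (c.classicalStageRhs f y h)

/-- One step `y_n ↦ y_{n+1}` of size `h` of the classical EPIRK method for `y' = f(y)`. -/
def classicalStep {N : ℕ} (f : Vec N → Vec N) (y : Vec N) (h : ℝ) : Vec N :=
  c.classicalStage f y h c.s

end Coeffs

/-- The iterated forward difference at `0` depends only on the first entries. -/
theorem fwdDiff_iter_congr {N : ℕ} (q : ℕ) (u v : ℕ → Vec N) (n : ℕ)
    (huv : ∀ l ≤ n + q, u l = v l) : (fwdDiff 1)^[q] u n = (fwdDiff 1)^[q] v n := by
  rw [fwdDiff_iter_eq_sum_shift, fwdDiff_iter_eq_sum_shift]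
  refine Finset.sum_congr rfl fun k hk => ?_
  rw [Finset.mem_range] at hk
  rw [huv _ (by simp only [smul_eq_mul, mul_one]; omega)]

/-- The defining equations of the classical EPIRK method. -/
theorem Coeffs.classicalStage_eq (c : Coeffs) {N : ℕ} (f : Vec N → Vec N) (y : Vec N) (h : ℝ)
    (i : ℕ) (hi : 1 ≤ i) :
    c.classicalStage f y h i = c.classicalStageRhs f y h (c.classicalStage f y h) i := by
  refine explicitSeq_eq _ _ (fun x x' i hi hx => ?_) i hi
  unfold Coeffs.classicalStageRhs
  congr 1
  refine Finset.sum_congr rfl fun j hj => ?_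
  rw [Finset.mem_Icc] at hj
  rw [fwdDiff_iter_congr (j - 1) _ (fun l => remainder f y (x' l)) 0
    (fun l hl => by rw [hx l (by omega)])]

/-! ### Krylov (EPIRK-K) methods -/

/-- The Krylov space `K_M = span {f(y), J f(y), …, J^{M-1} f(y)}` with `J = f'(y)`. -/
def krylov {N : ℕ} (f : Vec N → Vec N) (y : Vec N) (M : ℕ) : Submodule ℝ (Vec N) :=
  Submodule.span ℝ (Set.range fun k : Fin M => ((fderiv ℝ f y) ^ (k : ℕ)) (f y))

/-- A matrix `V ∈ ℝ^{N × m}` with orthonormal columns, as a linear isometry `ℝ^m → ℝ^N`. -/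
abbrev OrthoMatrix (N m : ℕ) : Type := Vec m →ₗᵢ[ℝ] Vec N

/-- The transpose `Vᵀ`. -/
def transp {N m : ℕ} (V : OrthoMatrix N m) : Vec N →L[ℝ] Vec m :=
  ContinuousLinearMap.adjoint V.toContinuousLinearMap

/-- The reduced Jacobian `H = Vᵀ J V`, an `m × m` matrix. -/
def reducedJacobian {N m : ℕ} (f : Vec N → Vec N) (y : Vec N) (V : OrthoMatrix N m) :
    Vec m →L[ℝ] Vec m :=
  transp V ∘L fderiv ℝ f y ∘L V.toContinuousLinearMap

/-- The reduced difference
`d_q = ∑_{k=0}^{q} ((-1)^k C(q,k) η_{q-k} - H ((-1)^k C(q,k) λ_{q-k}))`, where the `l`-th entry of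
`x` is the pair `(λ_l, Y_l)` and `η_l = Vᵀ f(Y_l)`. -/
def reducedDiff {N m : ℕ} (f : Vec N → Vec N) (y : Vec N) (V : OrthoMatrix N m)
    (x : ℕ → Vec m × Vec N) (q : ℕ) : Vec m :=
  ∑ k ∈ Finset.range (q + 1),
    (((-1 : ℝ) ^ k * (q.choose k : ℝ)) • transp V (f (x (q - k)).2)
      - reducedJacobian f y V (((-1 : ℝ) ^ k * (q.choose k : ℝ)) • (x (q - k)).1))

/-- The orthogonal difference
`r̃_q^⊥ = ∑_{k=0}^{q} (-1)^k C(q,k) (f(Y_{q-k}) - V η_{q-k})`. -/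
def orthoDiff {N m : ℕ} (f : Vec N → Vec N) (V : OrthoMatrix N m)
    (x : ℕ → Vec m × Vec N) (q : ℕ) : Vec N :=
  ∑ k ∈ Finset.range (q + 1),
    ((-1 : ℝ) ^ k * (q.choose k : ℝ)) • (f (x (q - k)).2 - V (transp V (f (x (q - k)).2)))

namespace Coeffs

variable (c : Coeffs)

/-- The reduced stage vector
`λ_i = λ_0 + h w_{i,1} ψ_1(h g_{i,1} H) η_0 + ∑_{j=2}^{i} h w_{i,j} ψ_j(h g_{i,j} H) d_{j-1}`,
with `λ_0 = Vᵀ y`, `η_0 = Vᵀ f(y)`. -/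
def reducedStageRhs {N m : ℕ} (f : Vec N → Vec N) (y : Vec N) (V : OrthoMatrix N m) (h : ℝ)
    (x : ℕ → Vec m × Vec N) (i : ℕ) : Vec m :=
  transp V y
    + (h * c.weight i 1) • c.psi 1 ((h * c.g i 1) • reducedJacobian f y V) (transp V (f y))
    + ∑ j ∈ Finset.Icc 2 i, (h * c.weight i j) •
        c.psi j ((h * c.g i j) • reducedJacobian f y V) (reducedDiff f y V x (j - 1))

/-- The full stage vector `Y_i = V λ_i + (y - V λ_0) + h w_{i,1} p̃_1 (f(y) - V η_0)
+ ∑_{j=2}^{i} h w_{i,j} p̃_j r̃_{j-1}^⊥`. -/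
def fullStageRhs {N m : ℕ} (f : Vec N → Vec N) (y : Vec N) (V : OrthoMatrix N m) (h : ℝ)
    (x : ℕ → Vec m × Vec N) (i : ℕ) : Vec N :=
  V (c.reducedStageRhs f y V h x i) + (y - V (transp V y))
    + (h * c.weight i 1 * c.ptilde 1) • (f y - V (transp V (f y)))
    + ∑ j ∈ Finset.Icc 2 i, (h * c.weight i j * c.ptilde j) • orthoDiff f V x (j - 1)

/-- The pairs `(λ_i, Y_i)`, `i = 0, …, s`, computed by one EPIRK-K step. -/
def krylovStage {N m : ℕ} (f : Vec N → Vec N) (y : Vec N) (V : OrthoMatrix N m) (h : ℝ) :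
    ℕ → Vec m × Vec N :=
  explicitSeq (transp V y, y)
    (fun x i => (c.reducedStageRhs f y V h x i, c.fullStageRhs f y V h x i))

/-- One step `y_n ↦ y_{n+1}` of size `h` of the EPIRK-K method for `y' = f(y)`, for a given
orthonormal basis `V` of the Krylov space. -/
def krylovStep {N m : ℕ} (f : Vec N → Vec N) (y : Vec N) (V : OrthoMatrix N m) (h : ℝ) : Vec N :=
  (c.krylovStage f y V h c.s).2

/-- The defining equations of the EPIRK-K method. -/
theorem krylovStage_eq {N m : ℕ} (f : Vec N → Vec N) (y : Vec N) (V : OrthoMatrix N m) (h : ℝ)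
    (i : ℕ) (hi : 1 ≤ i) :
    c.krylovStage f y V h i =
      (c.reducedStageRhs f y V h (c.krylovStage f y V h) i,
        c.fullStageRhs f y V h (c.krylovStage f y V h) i) := by
  refine explicitSeq_eq _ (fun x i => (c.reducedStageRhs f y V h x i, c.fullStageRhs f y V h x i))
    (fun x x' i hi hx => ?_) i hi
  have h1 : c.reducedStageRhs f y V h x i = c.reducedStageRhs f y V h x' i := by
    unfold Coeffs.reducedStageRhs
    congr 1
    refine Finset.sum_congr rfl fun j hj => ?_
    rw [Finset.mem_Icc] at hj
    congr 2
    refine Finset.sum_congr rfl fun k hk => ?_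
    rw [hx (j - 1 - k) (by omega)]
  have h2 : c.fullStageRhs f y V h x i = c.fullStageRhs f y V h x' i := by
    unfold Coeffs.fullStageRhs
    rw [h1]
    congr 1
    refine Finset.sum_congr rfl fun j hj => ?_
    rw [Finset.mem_Icc] at hj
    congr 1
    refine Finset.sum_congr rfl fun k hk => ?_
    rw [hx (j - 1 - k) (by omega)]
  exact Prod.ext h1 h2

end Coeffs

/-! ### Order -/

/-- One step `h ↦ step h` from `y` has local error `O(h^{p+1})` as `h → 0⁺`: it agrees up to order
`p` in `h` with the exact solution of `y' = f(y)` through `y`. -/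
def LocalErrorOrder {N : ℕ} (f : Vec N → Vec N) (y : Vec N) (step : ℝ → Vec N) (p : ℕ) : Prop :=
  ∀ (t₀ : ℝ) (u : ℝ → Vec N), u t₀ = y → (∀ᶠ t in 𝓝 t₀, HasDerivAt u (f (u t)) t) →
    (fun h : ℝ => step h - u (t₀ + h)) =O[𝓝[>] 0] (fun h : ℝ => h ^ (p + 1))

/-- The coefficients define a classical EPIRK method of order (at least) `p`: for every smooth
autonomous system, of any dimension, and every initial value, the local error is `O(h^{p+1})`. -/
def Coeffs.HasClassicalOrder (c : Coeffs) (p : ℕ) : Prop :=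
  ∀ (N : ℕ) (f : Vec N → Vec N), ContDiff ℝ ∞ f → ∀ y : Vec N,
    LocalErrorOrder f y (c.classicalStep f y) p

/-- The coefficients define a `K`-method, with Krylov spaces `K_M`, of order (at least) `p`: for
every smooth autonomous system, of any dimension, every initial value, and every orthonormal basis
`V` of `K_M`, the local error is `O(h^{p+1})`. The number `m` of columns of `V` is `dim K_M`, so
`m = M` unless `f(y), J f(y), …, J^{M-1} f(y)` are linearly dependent. -/
def Coeffs.HasKrylovOrder (c : Coeffs) (M p : ℕ) : Prop :=
  ∀ (N : ℕ) (f : Vec N → Vec N), ContDiff ℝ ∞ f → ∀ y : Vec N,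
    ∀ (m : ℕ) (V : OrthoMatrix N m), LinearMap.range V.toLinearMap = krylov f y M →
      LocalErrorOrder f y (c.krylovStep f y V) p

end

end EPIRK

namespace EPIRK

noncomputable section

/-! ### Estimates for the functions `φ_k` and `ψ_j` -/

section Phi

variable {𝔸 : Type*} [NormedRing 𝔸] [NormedAlgebra ℝ 𝔸]

/-! With J = f'(y), the `K`-method is exactly the EPIRK scheme in which J is replaced by A = V H Vᵀ
(`isOpStage_krylovStage`). Indeed A acts as H on range V and vanishes on its orthogonal complement,
where ψ_j reduces to its constant term p̃_j. It remains to see how far replacing J by A perturbs the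
stages.

Since M ≥ 3, the vectors f, Jf, J²f lie in range V, so Af = Jf and AJf = J²f. Three errors arise,
each O(h⁴) (`isBigO_stage_sub_stage`): (1) ψ_1(hA)f and ψ_1(hJ)f agree through degree 2, and the
term carries a factor h. (2) By induction on the stages, the remainders formed with A and with J
differ by O(h³). The critical part is (A - J)(Y - y), where Y - y = h ψ_1(hJ)f + O(h³) up to
coefficients and A - J kills f and Jf. Another factor h follows. (3) ψ_j(hA) - ψ_j(hJ) = O(h) acts
on h times a remainder of size O(h²). Adding the local error of the classical method gives order
three. -/

theorem norm_phi_term_le (k i : ℕ) (Z : 𝔸) :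
    ‖((i + k)! : ℝ)⁻¹ • Z ^ i‖ ≤ (‖(1 : 𝔸)‖ + 1) * (‖Z‖ ^ i / (i ! : ℝ)) := by
  -- No normalization ‖1‖ = 1 is assumed: ‖1‖ serves for i = 0, and the added 1 makes the constant
  -- at least 1 for i > 0.
  have h1 : ‖Z ^ i‖ ≤ (‖(1 : 𝔸)‖ + 1) * ‖Z‖ ^ i := by
    rcases Nat.eq_zero_or_pos i with rfl | hi
    · simp
    · calc ‖Z ^ i‖ ≤ ‖Z‖ ^ i := norm_pow_le' Z hi
        _ ≤ (‖(1 : 𝔸)‖ + 1) * ‖Z‖ ^ i :=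
          le_mul_of_one_le_left (by positivity) (by linarith [norm_nonneg (1 : 𝔸)])
  have h2 : ((i + k)! : ℝ)⁻¹ ≤ (i ! : ℝ)⁻¹ := by
    gcongr
    omega
  rw [norm_smul, Real.norm_of_nonneg (by positivity)]
  calc ((i + k)! : ℝ)⁻¹ * ‖Z ^ i‖ ≤ (i ! : ℝ)⁻¹ * ((‖(1 : 𝔸)‖ + 1) * ‖Z‖ ^ i) := by gcongr
    _ = _ := by ring

theorem norm_phi_le (k : ℕ) (Z : 𝔸) : ‖phi k Z‖ ≤ (‖(1 : 𝔸)‖ + 1) * Real.exp ‖Z‖ := by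
  have hs := ((Real.summable_pow_div_factorial ‖Z‖).mul_left (‖(1 : 𝔸)‖ + 1)).hasSum
  have h := tsum_of_norm_bounded hs fun i => norm_phi_term_le k i Z
  rwa [tsum_mul_left, ← congrFun (NormedSpace.exp_eq_tsum_div (𝔸 := ℝ)) ‖Z‖,
    ← Real.exp_eq_exp_ℝ] at h

variable [CompleteSpace 𝔸]

theorem summable_phi (k : ℕ) (Z : 𝔸) : Summable fun i : ℕ => ((i + k)! : ℝ)⁻¹ • Z ^ i :=
  Summable.of_norm_bounded ((Real.summable_pow_div_factorial ‖Z‖).mul_left (‖(1 : 𝔸)‖ + 1))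
    fun i => norm_phi_term_le k i Z

/-- Splitting off the constant term of the series. Iterated, this yields every Taylor expansion
below, with remainder φ_{k+n}(Z) Zⁿ. -/
theorem phi_eq_add_mul (k : ℕ) (Z : 𝔸) :
    phi k Z = (k ! : ℝ)⁻¹ • (1 : 𝔸) + phi (k + 1) Z * Z := by
  rw [phi, (summable_phi k Z).tsum_eq_zero_add, phi, ← (summable_phi (k + 1) Z).tsum_mul_right]
  simp only [zero_add, pow_zero, smul_mul_assoc, ← pow_succ]
  congr 2
  funext i
  rw [show i + 1 + k = i + (k + 1) by omega]

end Phi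

theorem isBigO_sum_smul {ι E : Type*} [NormedAddCommGroup E] [NormedSpace ℝ E] {l : Filter ℝ}
    (s : Finset ι) (a : ι → ℝ) {F : ι → ℝ → E} {α : ℝ → ℝ} (hF : ∀ i ∈ s, F i =O[l] α) :
    (fun h => ∑ i ∈ s, a i • F i h) =O[l] α := by
  have := IsBigO.sum (A := fun i h => a i • F i h) fun i hi => (hF i hi).const_smul_left (a i)
  simpa only [Finset.sum_fn] using this

section PhiApply

variable {N : ℕ}

/-- Only the constant term survives on the kernel; this is the source of the weights p̃_j. -/
theorem phi_apply_of_map_eq_zero (k : ℕ) (Z : Vec N →L[ℝ] Vec N) (v : Vec N) (hv : Z v = 0) :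
    phi k Z v = (k ! : ℝ)⁻¹ • v := by
  rw [phi_eq_add_mul]
  simp [hv]

/-- The relation AV = VH passes to powers, hence to convergent power series. -/
theorem phi_apply_intertwine {m : ℕ} (k : ℕ) (V : Vec m →L[ℝ] Vec N) (A : Vec N →L[ℝ] Vec N)
    (H : Vec m →L[ℝ] Vec m) (hV : ∀ v, A (V v) = V (H v)) (v : Vec m) :
    V (phi k H v) = phi k A (V v) := by
  have hpow : ∀ i : ℕ, ∀ v, (A ^ i) (V v) = V ((H ^ i) v) := by
    intro i
    induction i with
    | zero => simp
    | succ i ih => intro v; rw [pow_succ, pow_succ]; simp [hV, ih]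
  have h1 := ((summable_phi k H).hasSum.mapL (ContinuousLinearMap.apply ℝ (Vec m) v)).mapL V
  have h2 := (summable_phi k A).hasSum.mapL (ContinuousLinearMap.apply ℝ (Vec N) (V v))
  have hterm : ∀ i : ℕ, V (ContinuousLinearMap.apply ℝ (Vec m) v (((i + k)! : ℝ)⁻¹ • H ^ i)) =
      ContinuousLinearMap.apply ℝ (Vec N) (V v) (((i + k)! : ℝ)⁻¹ • A ^ i) := fun i => by
    simp [hpow]
  simp only [hterm] at h1
  exact h1.unique h2

theorem isBigO_phi_smul (k : ℕ) (g : ℝ) (B : Vec N →L[ℝ] Vec N) :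
    (fun h : ℝ => phi k ((g * h) • B)) =O[𝓝[>] 0] (fun _ => (1 : ℝ)) := by
  refine IsBigO.trans (g := fun h : ℝ => Real.exp ‖(g * h) • B‖)
    (IsBigO.of_bound (‖(1 : Vec N →L[ℝ] Vec N)‖ + 1) (Eventually.of_forall fun h => ?_)) ?_
  · rw [Real.norm_of_nonneg (Real.exp_nonneg _)]
    exact norm_phi_le k _
  · have hc : Continuous fun h : ℝ => Real.exp ‖(g * h) • B‖ := by fun_prop
    exact ((hc.tendsto 0).mono_left nhdsWithin_le_nhds).isBigO_one ℝ

/-- The constant terms cancel, whatever the two operators are. -/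
theorem isBigO_phi_sub_phi (k : ℕ) (g : ℝ) (A J : Vec N →L[ℝ] Vec N) :
    (fun h : ℝ => phi k ((g * h) • A) - phi k ((g * h) • J)) =O[𝓝[>] 0] (fun h => h) := by
  have key : ∀ B : Vec N →L[ℝ] Vec N,
      (fun h : ℝ => phi (k + 1) ((g * h) • B) * ((g * h) • B)) =O[𝓝[>] 0] (fun h => h) := by
    intro B
    have h1 : (fun h : ℝ => (g * h) • B) =O[𝓝[>] 0] (fun h => h) :=
      IsBigO.of_bound (|g| * ‖B‖) (Eventually.of_forall fun h => by
        simp only [norm_smul, norm_mul, Real.norm_eq_abs]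
        exact le_of_eq (by ring))
    simpa using (isBigO_phi_smul (k + 1) g B).mul h1
  refine ((key A).sub (key J)).congr_left fun h => ?_
  rw [phi_eq_add_mul k ((g * h) • A), phi_eq_add_mul k ((g * h) • J)]
  abel

/-- If `A` and `J` generate the same first three Krylov vectors from `v`, then `φ_k(h A) v` and
`φ_k(h J) v` agree up to `O(h ^ 3)`. -/
theorem isBigO_phi_sub_phi_apply (k : ℕ) (g : ℝ) (A J : Vec N →L[ℝ] Vec N) (v : Vec N)
    (h₁ : A v = J v) (h₂ : A (J v) = J (J v)) :
    (fun h : ℝ => phi k ((g * h) • A) v - phi k ((g * h) • J) v) =O[𝓝[>] 0]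
      (fun h => h ^ 3) := by
  -- Degrees 0 and 1 cancel, and both quadratic remainders act on the same vector J(Jv). The third
  -- power of h comes from the difference of the two operators φ_{k+2}.
  have hexp : ∀ h : ℝ, phi k ((g * h) • A) v - phi k ((g * h) • J) v =
      (g * h) ^ 2 • ((phi (k + 2) ((g * h) • A) - phi (k + 2) ((g * h) • J)) (J (J v))) := by
    intro h
    rw [phi_eq_add_mul k ((g * h) • A), phi_eq_add_mul k ((g * h) • J),
      phi_eq_add_mul (k + 1) ((g * h) • A), phi_eq_add_mul (k + 1) ((g * h) • J)]
    simp only [add_apply, sub_apply,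
      mul_apply_eq_comp, smul_apply, map_smul, h₁, h₂,
      one_apply_eq_self]
    module
  simp only [hexp]
  have hg : (fun h : ℝ => (g * h) ^ 2) =O[𝓝[>] 0] (fun h => h ^ 2) :=
    IsBigO.of_bound (|g| ^ 2) (Eventually.of_forall fun h => by
      simp only [norm_pow, norm_mul, Real.norm_eq_abs]
      exact le_of_eq (by ring))
  have hv := (ContinuousLinearMap.apply ℝ (Vec N) (J (J v))).isBigO_comp
    (fun h : ℝ => phi (k + 2) ((g * h) • A) - phi (k + 2) ((g * h) • J)) (𝓝[>] 0)
  refine (hg.smul (hv.trans (isBigO_phi_sub_phi (k + 2) g A J))).congr_right fun h => ?_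
  simp only [smul_eq_mul]
  ring

/-- D kills the terms of degree 0 and 1 of the series. It is applied with D = A - J. -/
theorem isBigO_map_phi_apply (k : ℕ) (g : ℝ) (D J : Vec N →L[ℝ] Vec N) (v : Vec N)
    (h₁ : D v = 0) (h₂ : D (J v) = 0) :
    (fun h : ℝ => D (phi k ((g * h) • J) v)) =O[𝓝[>] 0] (fun h => h ^ 2) := by
  have hexp : ∀ h : ℝ, D (phi k ((g * h) • J) v) =
      (g * h) ^ 2 • D (phi (k + 2) ((g * h) • J) (J (J v))) := by
    intro h
    rw [phi_eq_add_mul k ((g * h) • J), phi_eq_add_mul (k + 1) ((g * h) • J)]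
    simp only [add_apply, map_add,
      mul_apply_eq_comp, smul_apply, map_smul, h₁, h₂,
      one_apply_eq_self]
    module
  simp only [hexp]
  have hg : (fun h : ℝ => (g * h) ^ 2) =O[𝓝[>] 0] (fun h => h ^ 2) :=
    IsBigO.of_bound (|g| ^ 2) (Eventually.of_forall fun h => by
      simp only [norm_pow, norm_mul, Real.norm_eq_abs]
      exact le_of_eq (by ring))
  have hv := (D ∘L ContinuousLinearMap.apply ℝ (Vec N) (J (J v))).isBigO_comp
    (fun h : ℝ => phi (k + 2) ((g * h) • J)) (𝓝[>] 0)
  simpa using hg.smul (hv.trans (isBigO_phi_smul (k + 2) g J))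

end PhiApply

namespace Coeffs

variable (c : Coeffs) {N : ℕ}

theorem psi_apply (j : ℕ) (Z : Vec N →L[ℝ] Vec N) (v : Vec N) :
    c.psi j Z v = ∑ k ∈ Finset.Icc 1 j, c.p j k • phi k Z v := by
  simp [psi]

theorem psi_apply_of_map_eq_zero (j : ℕ) (Z : Vec N →L[ℝ] Vec N) (v : Vec N) (hv : Z v = 0) :
    c.psi j Z v = c.ptilde j • v := by
  rw [psi_apply, ptilde, Finset.sum_smul]
  refine Finset.sum_congr rfl fun k _ => ?_
  rw [phi_apply_of_map_eq_zero k Z v hv, smul_smul, div_eq_mul_inv]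

theorem psi_apply_intertwine {m : ℕ} (j : ℕ) (V : Vec m →L[ℝ] Vec N) (A : Vec N →L[ℝ] Vec N)
    (H : Vec m →L[ℝ] Vec m) (hV : ∀ v, A (V v) = V (H v)) (v : Vec m) :
    V (c.psi j H v) = c.psi j A (V v) := by
  simp only [psi_apply, map_sum, map_smul, phi_apply_intertwine _ V A H hV]

theorem isBigO_psi_smul (j : ℕ) (g : ℝ) (B : Vec N →L[ℝ] Vec N) :
    (fun h : ℝ => c.psi j ((g * h) • B)) =O[𝓝[>] 0] (fun _ => (1 : ℝ)) :=
  isBigO_sum_smul _ _ fun k _ => isBigO_phi_smul k g B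

theorem isBigO_psi_sub_psi (j : ℕ) (g : ℝ) (A J : Vec N →L[ℝ] Vec N) :
    (fun h : ℝ => c.psi j ((g * h) • A) - c.psi j ((g * h) • J)) =O[𝓝[>] 0] (fun h => h) := by
  have h : ∀ h : ℝ, c.psi j ((g * h) • A) - c.psi j ((g * h) • J) =
      ∑ k ∈ Finset.Icc 1 j, c.p j k • (phi k ((g * h) • A) - phi k ((g * h) • J)) := fun h => by
    simp only [psi, smul_sub, Finset.sum_sub_distrib]
  simp only [h]
  exact isBigO_sum_smul _ _ fun k _ => isBigO_phi_sub_phi k g A J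

theorem isBigO_psi_sub_psi_apply (j : ℕ) (g : ℝ) (A J : Vec N →L[ℝ] Vec N) (v : Vec N)
    (h₁ : A v = J v) (h₂ : A (J v) = J (J v)) :
    (fun h : ℝ => c.psi j ((g * h) • A) v - c.psi j ((g * h) • J) v) =O[𝓝[>] 0]
      (fun h => h ^ 3) := by
  simp only [psi_apply, ← Finset.sum_sub_distrib, ← smul_sub]
  exact isBigO_sum_smul _ _ fun k _ => isBigO_phi_sub_phi_apply k g A J v h₁ h₂

theorem isBigO_map_psi_apply (j : ℕ) (g : ℝ) (D J : Vec N →L[ℝ] Vec N) (v : Vec N)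
    (h₁ : D v = 0) (h₂ : D (J v) = 0) :
    (fun h : ℝ => D (c.psi j ((g * h) • J) v)) =O[𝓝[>] 0] (fun h => h ^ 2) := by
  simp only [psi_apply, map_sum, map_smul]
  exact isBigO_sum_smul _ _ fun k _ => isBigO_map_phi_apply k g D J v h₁ h₂

end Coeffs

theorem isBigO_clm_apply {N : ℕ} {l : Filter ℝ} {T : ℝ → Vec N →L[ℝ] Vec N} {x : ℝ → Vec N}
    {α β : ℝ → ℝ} (hT : T =O[l] α) (hx : x =O[l] β) :
    (fun h => T h (x h)) =O[l] (fun h => α h * β h) :=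
  (IsBigO.of_bound (g := fun h => ‖T h‖ * ‖x h‖) 1 (Eventually.of_forall fun h => by
    simpa using (T h).le_opNorm (x h))).trans (hT.norm_left.mul hx.norm_left)

/-! ### Forward differences -/

/-- Reindexed by k ↦ q - k to match the sums that define `reducedDiff` and `orthoDiff`. -/
theorem fwdDiff_iter_zero_eq_sum {N : ℕ} (q : ℕ) (u : ℕ → Vec N) :
    (fwdDiff 1)^[q] u 0 =
      ∑ k ∈ Finset.range (q + 1), ((-1 : ℝ) ^ k * (q.choose k : ℝ)) • u (q - k) := by
  rw [fwdDiff_iter_eq_sum_shift, ← Finset.sum_range_reflect]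
  refine Finset.sum_congr rfl fun k hk => ?_
  have hk' : k ≤ q := by rw [Finset.mem_range] at hk; omega
  rw [show q + 1 - 1 - k = q - k by omega, Nat.choose_symm hk', Nat.sub_sub_self hk',
    ← Int.cast_smul_eq_zsmul ℝ]
  simp

theorem alternating_sum_choose_eq_zero {q : ℕ} (hq : q ≠ 0) :
    ∑ k ∈ Finset.range (q + 1), (-1 : ℝ) ^ k * (q.choose k : ℝ) = 0 := by
  exact_mod_cast congrArg (Int.cast : ℤ → ℝ) (Int.alternating_sum_range_choose_of_ne hq)

theorem isBigO_fwdDiff_iter {N : ℕ} {l : Filter ℝ} (q : ℕ) {x : ℝ → ℕ → Vec N} {α : ℝ → ℝ}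
    (hx : ∀ i ≤ q, (fun h => x h i) =O[l] α) :
    (fun h => (fwdDiff 1)^[q] (x h) 0) =O[l] α := by
  simp only [fwdDiff_iter_zero_eq_sum]
  exact isBigO_sum_smul _ _ fun k _ => hx (q - k) (Nat.sub_le q k)

/-! ### EPIRK stages with an arbitrary Jacobian approximation -/

/-- A `C^2` map differs from its linearization by a quadratic term. -/
theorem isBigO_taylor_remainder {N : ℕ} {f : Vec N → Vec N} (hf : ContDiff ℝ ∞ f) (y : Vec N) :
    (fun z => f z - f y - fderiv ℝ f y (z - y)) =O[𝓝 y] (fun z => ‖z - y‖ ^ 2) := by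
  have hd : ContDiffAt ℝ 1 (fderiv ℝ f) y :=
    (hf.fderiv_right (m := 1) (by norm_cast)).contDiffAt
  obtain ⟨K, t, ht, hK⟩ := hd.exists_lipschitzOnWith
  obtain ⟨ε, hε, hεt⟩ := Metric.mem_nhds_iff.1 ht
  refine IsBigO.of_bound K ?_
  filter_upwards [Metric.ball_mem_nhds y hε] with z hz
  -- The mean value inequality is used on the ball of radius exactly ‖z - y‖, where the derivative
  -- deviates from f'(y) by at most K‖z - y‖.
  have hsub : Metric.closedBall y ‖z - y‖ ⊆ t := fun x hx => hεt (by
    rw [Metric.mem_closedBall] at hx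
    rw [Metric.mem_ball, dist_eq_norm] at hz
    exact lt_of_le_of_lt hx hz)
  have hyt : y ∈ t := hεt (Metric.mem_ball_self hε)
  have hfd : Differentiable ℝ f := hf.differentiable (by simp)
  have : ‖f z - f y - fderiv ℝ f y (z - y)‖ ≤ K * ‖z - y‖ * ‖z - y‖ :=
    (convex_closedBall y ‖z - y‖).norm_image_sub_le_of_norm_hasFDerivWithin_le' (f' := fderiv ℝ f)
    (fun x _ => (hfd x).hasFDerivAt.hasFDerivWithinAt)
    (fun x hx => by
      rw [Metric.mem_closedBall] at hx
      calc ‖fderiv ℝ f x - fderiv ℝ f y‖ = dist (fderiv ℝ f x) (fderiv ℝ f y) :=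
            (dist_eq_norm _ _).symm
        _ ≤ K * dist x y := hK.dist_le_mul x (hsub (Metric.mem_closedBall.2 hx)) y hyt
        _ ≤ K * ‖z - y‖ := by gcongr)
    (Metric.mem_closedBall_self (norm_nonneg _))
    (by rw [Metric.mem_closedBall, dist_eq_norm])
  rw [norm_pow, norm_norm]
  calc _ ≤ K * ‖z - y‖ * ‖z - y‖ := this
    _ = _ := by ring

namespace Coeffs

variable (c : Coeffs) {N : ℕ}

/-- The sequence `Y` consists of EPIRK stages in which `B` replaces the exact Jacobian. -/
def IsOpStage (f : Vec N → Vec N) (y : Vec N) (B : Vec N →L[ℝ] Vec N) (h : ℝ)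
    (Y : ℕ → Vec N) : Prop :=
  Y 0 = y ∧ ∀ i, 1 ≤ i → Y i =
    y + c.weight i 1 • c.psi 1 ((c.g i 1 * h) • B) (h • f y)
      + ∑ j ∈ Finset.Icc 2 i, c.weight i j • c.psi j ((c.g i j * h) • B)
          (h • (fwdDiff 1)^[j - 1] (fun l : ℕ => f (Y l) - f y - B (Y l - y)) 0)

theorem isOpStage_classicalStage (f : Vec N → Vec N) (y : Vec N) (h : ℝ) :
    c.IsOpStage f y (fderiv ℝ f y) h (c.classicalStage f y h) :=
  ⟨rfl, fun i hi => c.classicalStage_eq f y h i hi⟩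

variable {c} {f : Vec N → Vec N} {y : Vec N}

theorem isBigO_pow_pow {a b : ℕ} (hab : a ≤ b) :
    (fun h : ℝ => h ^ b) =O[𝓝[>] 0] (fun h => h ^ a) := by
  refine IsBigO.of_bound 1 ?_
  filter_upwards [Ioc_mem_nhdsGT (zero_lt_one' ℝ)] with h hh
  rw [one_mul, norm_pow, norm_pow, Real.norm_of_nonneg hh.1.le]
  exact pow_le_pow_of_le_one hh.1.le hh.2 hab

theorem tendsto_of_isBigO_sub {Z : ℝ → Vec N} (hZ : (fun h => Z h - y) =O[𝓝[>] 0] (fun h => h)) :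
    Tendsto Z (𝓝[>] 0) (𝓝 y) := by
  have h0 : Tendsto (fun h : ℝ => h) (𝓝[>] 0) (𝓝 0) := nhdsWithin_le_nhds
  exact tendsto_sub_nhds_zero_iff.1 (hZ.trans_tendsto h0)

theorem isBigO_remainder (hf : ContDiff ℝ ∞ f) {Z : ℝ → Vec N}
    (hZ : (fun h => Z h - y) =O[𝓝[>] 0] (fun h => h)) :
    (fun h => f (Z h) - f y - fderiv ℝ f y (Z h - y)) =O[𝓝[>] 0] (fun h => h ^ 2) :=
  ((isBigO_taylor_remainder hf y).comp_tendsto (tendsto_of_isBigO_sub hZ)).trans (hZ.norm_left.pow 2)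

theorem isBigO_smul_self {x : ℝ → Vec N} {n : ℕ} (hx : x =O[𝓝[>] 0] (fun h => h ^ n)) :
    (fun h : ℝ => h • x h) =O[𝓝[>] 0] (fun h => h ^ (n + 1)) :=
  ((isBigO_refl (fun h : ℝ => h) _).smul hx).congr_right fun h => by
    rw [smul_eq_mul, pow_succ']

/-- The contribution of the nonlinear remainders to a stage with exact Jacobian. -/
theorem isBigO_stage_remainder (hf : ContDiff ℝ ∞ f) {Y : ℝ → ℕ → Vec N} {i : ℕ}
    (hY : ∀ l < i, (fun h => Y h l - y) =O[𝓝[>] 0] (fun h => h)) :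
    (fun h => ∑ j ∈ Finset.Icc 2 i, c.weight i j • c.psi j ((c.g i j * h) • fderiv ℝ f y)
      (h • (fwdDiff 1)^[j - 1] (fun l : ℕ => f (Y h l) - f y - fderiv ℝ f y (Y h l - y)) 0))
      =O[𝓝[>] 0] (fun h => h ^ 3) := by
  refine isBigO_sum_smul _ _ fun j hj => ?_
  rw [Finset.mem_Icc] at hj
  have h1 := isBigO_fwdDiff_iter (j - 1) fun l (hl : l ≤ j - 1) =>
    isBigO_remainder hf (hY l (by omega))
  simpa using isBigO_clm_apply (c.isBigO_psi_smul j (c.g i j) (fderiv ℝ f y)) (isBigO_smul_self h1)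

/-- Stage vectors of a method with exact Jacobian stay within `O(h)` of the initial value. -/
theorem isBigO_stage_sub (hf : ContDiff ℝ ∞ f) {Y : ℝ → ℕ → Vec N}
    (hY : ∀ h, c.IsOpStage f y (fderiv ℝ f y) h (Y h)) (i : ℕ) :
    (fun h => Y h i - y) =O[𝓝[>] 0] (fun h => h) := by
  induction i using Nat.strong_induction_on with
  | _ i ih =>
    rcases Nat.eq_zero_or_pos i with rfl | hi
    · simpa [fun h => (hY h).1] using isBigO_zero _ _
    · have h1 := (isBigO_stage_remainder (c := c) hf ih).trans (isBigO_pow_pow (show 1 ≤ 3 by omega))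
      have h2 : (fun h : ℝ => h • f y) =O[𝓝[>] 0] (fun h => h ^ 1) :=
        isBigO_smul_self (n := 0) (by simpa using isBigO_const_const (f y) (one_ne_zero (α := ℝ)) (𝓝[>] (0 : ℝ)))
      have h3 := (isBigO_clm_apply (c.isBigO_psi_smul 1 (c.g i 1) (fderiv ℝ f y))
        h2).const_smul_left (c.weight i 1)
      simp only [one_mul, pow_one] at h1 h3
      refine (h3.add h1).congr_left fun h => ?_
      rw [(hY h).2 i hi, Pi.smul_apply]
      abel

/-- An operator vanishing on `f y` and `J (f y)` maps the stage increments of a method with exact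
Jacobian `J` to terms of size `O(h ^ 3)`. -/
theorem isBigO_map_stage_sub (hf : ContDiff ℝ ∞ f) {Y : ℝ → ℕ → Vec N}
    (hY : ∀ h, c.IsOpStage f y (fderiv ℝ f y) h (Y h)) (D : Vec N →L[ℝ] Vec N)
    (h₁ : D (f y) = 0) (h₂ : D (fderiv ℝ f y (f y)) = 0) (i : ℕ) :
    (fun h => D (Y h i - y)) =O[𝓝[>] 0] (fun h => h ^ 3) := by
  rcases Nat.eq_zero_or_pos i with rfl | hi
  · simpa [fun h => (hY h).1] using isBigO_zero _ _
  · have h3 := (D.isBigO_comp _ _).trans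
      (isBigO_stage_remainder (c := c) hf (i := i) fun l _ => isBigO_stage_sub hf hY l)
    have h4 := (isBigO_smul_self
      (c.isBigO_map_psi_apply 1 (c.g i 1) D _ (f y) h₁ h₂)).const_smul_left (c.weight i 1)
    refine (h4.add h3).congr_left fun h => ?_
    rw [(hY h).2 i hi, add_assoc, add_sub_cancel_left, map_add, Pi.smul_apply, map_smul, map_smul,
      map_smul]

/-- Replacing the exact Jacobian `J` by an operator `A` with `A f = J f` and `A J f = J ^ 2 f`
changes the stages by `O(h ^ 4)`. -/
theorem isBigO_stage_sub_stage (hf : ContDiff ℝ ∞ f) {X Y : ℝ → ℕ → Vec N}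
    {A : Vec N →L[ℝ] Vec N} (hX : ∀ h, c.IsOpStage f y A h (X h))
    (hY : ∀ h, c.IsOpStage f y (fderiv ℝ f y) h (Y h)) (h₁ : A (f y) = fderiv ℝ f y (f y))
    (h₂ : A (fderiv ℝ f y (f y)) = fderiv ℝ f y (fderiv ℝ f y (f y))) (i : ℕ) :
    (fun h => X h i - Y h i) =O[𝓝[>] 0] (fun h => h ^ 4) := by
  have hYy := isBigO_stage_sub hf hY
  induction i using Nat.strong_induction_on with
  | _ i ih =>
    rcases Nat.eq_zero_or_pos i with rfl | hi
    · simpa [fun h => (hX h).1, fun h => (hY h).1] using isBigO_zero _ _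
    set J := fderiv ℝ f y with hJ
    -- The difference equals (f(X) - f(Y)) - A(X - Y) - (A - J)(Y - y). Induction controls the first
    -- two parts, and the vanishing of A - J on f and Jf controls the last.
    have hrem : ∀ l < i, (fun h => (f (X h l) - f y - A (X h l - y)) -
        (f (Y h l) - f y - J (Y h l - y))) =O[𝓝[>] 0] (fun h => h ^ 3) := by
      intro l hl
      have hXY := (ih l hl).trans (isBigO_pow_pow (show 3 ≤ 4 by omega))
      have hXy : (fun h => X h l - y) =O[𝓝[>] 0] (fun h => h) := by
        have := (ih l hl).trans (isBigO_pow_pow (show 1 ≤ 4 by omega))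
        simp only [pow_one] at this
        exact (this.add (hYy l)).congr_left fun h => by abel
      -- Strict differentiability makes f Lipschitz near y, and both stages tend to y.
      have hs : HasStrictFDerivAt f J y := hf.contDiffAt.hasStrictFDerivAt (by simp)
      have h3 := (hs.isBigO_sub.comp_tendsto ((tendsto_of_isBigO_sub hXy).prodMk_nhds
        (tendsto_of_isBigO_sub (hYy l)))).trans hXY
      have h4 := (A.isBigO_comp _ _).trans hXY
      have h5 := isBigO_map_stage_sub hf hY (A - J) (by simp [h₁]) (by simp [h₂, ← hJ]) l
      refine ((h3.sub h4).sub h5).congr_left fun h => ?_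
      simp only [Function.comp_apply, sub_apply, map_sub]
      abel
    -- Each term splits as ψ(A)(r_A - r_J) + (ψ(A) - ψ(J)) r_J: sizes h · h³ and h · (h · h²).
    have hsum : (fun h => ∑ j ∈ Finset.Icc 2 i, c.weight i j •
        (c.psi j ((c.g i j * h) • A)
          (h • (fwdDiff 1)^[j - 1] (fun l : ℕ => f (X h l) - f y - A (X h l - y)) 0) -
        c.psi j ((c.g i j * h) • J)
          (h • (fwdDiff 1)^[j - 1] (fun l : ℕ => f (Y h l) - f y - J (Y h l - y)) 0)))
        =O[𝓝[>] 0] (fun h => h ^ 4) := by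
      refine isBigO_sum_smul _ _ fun j hj => ?_
      rw [Finset.mem_Icc] at hj
      have h3 := isBigO_fwdDiff_iter (j - 1) fun l (hl : l ≤ j - 1) => hrem l (by omega)
      have h4 := isBigO_fwdDiff_iter (j - 1) fun l (_ : l ≤ j - 1) =>
        isBigO_remainder hf (hYy l)
      have h5 := isBigO_clm_apply (c.isBigO_psi_smul j (c.g i j) A) (isBigO_smul_self h3)
      have h6 := isBigO_clm_apply (c.isBigO_psi_sub_psi j (c.g i j) A J) (isBigO_smul_self h4)
      simp only [one_mul, ← pow_succ'] at h5 h6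
      refine (h5.add h6).congr_left fun h => ?_
      simp only [fwdDiff_iter_zero_eq_sum, smul_sub, Finset.sum_sub_distrib, map_sub, sub_apply]
      abel
    have hlin := (isBigO_smul_self
      (c.isBigO_psi_sub_psi_apply 1 (c.g i 1) A J (f y) h₁ h₂)).const_smul_left (c.weight i 1)
    refine (hlin.add hsum).congr_left fun h => ?_
    rw [(hX h).2 i hi, (hY h).2 i hi]
    simp only [Pi.smul_apply, smul_sub, Finset.sum_sub_distrib, map_smul]
    abel

end Coeffs

/-! ### The `K`-method as a method with a projected Jacobian -/

section Krylov

variable {N m : ℕ} {f : Vec N → Vec N} {y : Vec N} {V : OrthoMatrix N m}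

theorem transp_apply_self (V : OrthoMatrix N m) (v : Vec m) : transp V (V v) = v := by
  have h := V.adjoint_comp_self
  exact congrArg (fun T : Vec m →L[ℝ] Vec m => T v) h

theorem apply_transp_of_mem_range {x : Vec N} (hx : x ∈ LinearMap.range V.toLinearMap) :
    V (transp V x) = x := by
  obtain ⟨v, rfl⟩ := hx
  exact congrArg V (transp_apply_self V v)

/-- The projected Jacobian `V H Vᵀ`. -/
def projectedJacobian (f : Vec N → Vec N) (y : Vec N) (V : OrthoMatrix N m) : Vec N →L[ℝ] Vec N :=
  V.toContinuousLinearMap ∘L reducedJacobian f y V ∘L transp V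

theorem projectedJacobian_apply (f : Vec N → Vec N) (y : Vec N) (V : OrthoMatrix N m) (x : Vec N) :
    projectedJacobian f y V x = V (reducedJacobian f y V (transp V x)) := rfl

/-- A = (VVᵀ) J (VVᵀ), and the projection VVᵀ fixes both x and Jx. -/
theorem projectedJacobian_apply_of_mem {x : Vec N} (hx : x ∈ LinearMap.range V.toLinearMap)
    (hJx : fderiv ℝ f y x ∈ LinearMap.range V.toLinearMap) :
    projectedJacobian f y V x = fderiv ℝ f y x := by
  have h : projectedJacobian f y V x = V (transp V (fderiv ℝ f y (V (transp V x)))) := rfl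
  rw [h, apply_transp_of_mem_range hx, apply_transp_of_mem_range hJx]

theorem pow_apply_mem_krylov (f : Vec N → Vec N) (y : Vec N) {k M : ℕ} (hk : k < M) :
    ((fderiv ℝ f y) ^ k) (f y) ∈ krylov f y M :=
  Submodule.subset_span ⟨⟨k, hk⟩, rfl⟩

namespace Coeffs

variable (c : Coeffs)

/-- Split x into VVᵀx, where A is intertwined with H, and x - VVᵀx, which A kills. -/
theorem psi_projectedJacobian_apply (j : ℕ) (t : ℝ) (x : Vec N) :
    c.psi j (t • projectedJacobian f y V) x =
      V (c.psi j (t • reducedJacobian f y V) (transp V x)) +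
        c.ptilde j • (x - V (transp V x)) := by
  have h1 := c.psi_apply_intertwine j V.toContinuousLinearMap (t • projectedJacobian f y V)
    (t • reducedJacobian f y V) (fun v => by
      simp [projectedJacobian_apply, transp_apply_self]) (transp V x)
  have h2 := c.psi_apply_of_map_eq_zero j (t • projectedJacobian f y V) (x - V (transp V x)) (by
    simp [projectedJacobian_apply, transp_apply_self])
  rw [← h2]
  refine Eq.trans ?_ (congrArg (· + _) h1.symm)
  rw [LinearIsometry.coe_toContinuousLinearMap, ← map_add, add_sub_cancel]

theorem transp_orthoDiff (x : ℕ → Vec m × Vec N) (q : ℕ) : transp V (orthoDiff f V x q) = 0 := by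
  simp [orthoDiff, transp_apply_self]

/-- All corrections added to Vλ_i are orthogonal to range V. Hence VHλ_i = AY_i, which eliminates
the reduced variables. -/
theorem transp_krylovStage (h : ℝ) (i : ℕ) :
    transp V (c.krylovStage f y V h i).2 = (c.krylovStage f y V h i).1 := by
  rcases Nat.eq_zero_or_pos i with rfl | hi
  · rfl
  · rw [c.krylovStage_eq f y V h i hi]
    simp [fullStageRhs, transp_apply_self, transp_orthoDiff]

theorem isOpStage_krylovStage (h : ℝ) :
    c.IsOpStage f y (projectedJacobian f y V) h (fun i => (c.krylovStage f y V h i).2) := by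
  refine ⟨rfl, fun i hi => ?_⟩
  set x := c.krylovStage f y V h with hx
  set A := projectedJacobian f y V with hA
  -- A difference of order q ≥ 1 kills the constant f(y) - Ay, so only f(Y_l) - AY_l = V(η_l - Hλ_l)
  -- + (f(Y_l) - Vη_l) contributes.
  have hd : ∀ q, q ≠ 0 → (fwdDiff 1)^[q] (fun l : ℕ => f (x l).2 - f y - A ((x l).2 - y)) 0 =
      V (reducedDiff f y V x q) + orthoDiff f V x q := by
    intro q hq
    have h0 : ∑ k ∈ Finset.range (q + 1), ((-1 : ℝ) ^ k * (q.choose k : ℝ)) • (f y - A y) = 0 := by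
      rw [← Finset.sum_smul, alternating_sum_choose_eq_zero hq, zero_smul]
    rw [fwdDiff_iter_zero_eq_sum, reducedDiff, orthoDiff, map_sum, ← Finset.sum_add_distrib,
      ← sub_eq_zero, ← Finset.sum_sub_distrib, ← neg_eq_zero, ← h0, ← Finset.sum_neg_distrib]
    refine Finset.sum_congr rfl fun k _ => ?_
    rw [← c.transp_krylovStage h (q - k), ← hx, map_sub V, map_smul V, map_smul (reducedJacobian _ _ _),
      map_smul V, ← projectedJacobian_apply, ← hA, map_sub A]
    module
  have htd : ∀ q, transp V (V (reducedDiff f y V x q) + orthoDiff f V x q) =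
      reducedDiff f y V x q := fun q => by
    rw [map_add, transp_apply_self, transp_orthoDiff, add_zero]
  have hterm : ∀ j ∈ Finset.Icc 2 i, c.weight i j • c.psi j ((c.g i j * h) • A)
      (h • (fwdDiff 1)^[j - 1] (fun l : ℕ => f (x l).2 - f y - A ((x l).2 - y)) 0) =
      V ((h * c.weight i j) • c.psi j ((h * c.g i j) • reducedJacobian f y V)
        (reducedDiff f y V x (j - 1))) +
      (h * c.weight i j * c.ptilde j) • orthoDiff f V x (j - 1) := by
    intro j hj
    rw [Finset.mem_Icc] at hj
    rw [hd (j - 1) (by omega), map_smul, psi_projectedJacobian_apply, htd, add_sub_cancel_left,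
      map_smul V, mul_comm (c.g i j) h]
    module
  simp only [Finset.sum_congr rfl hterm, Finset.sum_add_distrib]
  rw [hx, c.krylovStage_eq f y V h i hi, ← hx]
  simp only [fullStageRhs, reducedStageRhs, map_add, map_sum, map_smul (c.psi 1 _), hA,
    psi_projectedJacobian_apply, map_smul V]
  rw [mul_comm (c.g i 1) h]
  module

end Coeffs

end Krylov

end

end EPIRK

/-! ### Transfer of order from the classical method to the `K`-method. -/

theorem mainTheorem5 (c : EPIRK.Coeffs) (p : ℕ) (hp : 3 ≤ p) (hc : c.HasClassicalOrder p)
    (M : ℕ) (hM : 3 ≤ M) : c.HasKrylovOrder M 3 := by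
  intro N f hf y m V hV t₀ u hu hsol
  -- This is where M ≥ 3 enters: AJf = J²f needs J²f itself in the Krylov space.
  have hmem : ∀ k < 3, ((fderiv ℝ f y) ^ k) (f y) ∈ LinearMap.range V.toLinearMap := fun k hk =>
    hV ▸ EPIRK.pow_apply_mem_krylov f y (by omega)
  have m0 : f y ∈ LinearMap.range V.toLinearMap := by simpa using hmem 0 (by omega)
  have m1 : fderiv ℝ f y (f y) ∈ LinearMap.range V.toLinearMap := by
    simpa using hmem 1 (by omega)
  have m2 : fderiv ℝ f y (fderiv ℝ f y (f y)) ∈ LinearMap.range V.toLinearMap := by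
    simpa [pow_two] using hmem 2 (by omega)
  have h1 := EPIRK.Coeffs.isBigO_stage_sub_stage hf
    (fun h => c.isOpStage_krylovStage (f := f) (y := y) (V := V) h)
    (fun h => c.isOpStage_classicalStage f y h)
    (EPIRK.projectedJacobian_apply_of_mem m0 m1) (EPIRK.projectedJacobian_apply_of_mem m1 m2) c.s
  have h2 := (hc N f hf y t₀ u hu hsol).trans
    (EPIRK.Coeffs.isBigO_pow_pow (show 3 + 1 ≤ p + 1 by omega))
  exact (h1.add h2).congr_left fun h => sub_add_sub_cancel _ _ _
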